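/- **Conventions.** All spaces $\mathbb R^k$ carry the Euclidean norm and linear operators the operator norm; for $c\in\mathbb R^j$, $c\le 0$ means $c_i\le 0$ for all $i$. For a map $f$ on a subset of a Euclidean space, $Lip(f)=\sup_{x\ne x'}|f(x)-f(x')|/|x-x'|$. $d_H$ is the Hausdorff distance on nonempty compact sets. *Property (CON).* A regular arc is a continuous, piecewise differentiable map $\gamma:[w_1,w_2]\to\mathbb R^m$ with bounded derivative and $\gamma'(t)\ne 0$ wherever the derivative exists; its length is $\ell(\gamma)=\int_{w_1}^{w_2}|\gamma'(t)|\,dt$. A nonempty connected set $X\subset\mathbb R^m$ has property (CON) with characteristic number $a(X)>0$ if any two distinct points $x_1,x_2\in X$ are the end points $\gamma(w_1)=x_1$, $\gamma(w_2)=x_2$ of a regular arc $\gamma$ in $X$ with $\ell(\gamma)\le a(X)|x_1-x_2|$. *Lipschitz manifolds.* $\mathcal M\subset\mathbb R^n$ is a $d$-dimensional Lipschitz manifold if every $u\in\mathcal M$ has a local chart $(W,\psi)$: $W$ is an open neighbourhood of $u$ in $\mathcal M$ and $\psi:W\to V$ is a homeomorphism onto an open set $V\subset\mathbb R^d$ with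 $\psi,\psi^{-1}$ Lipschitz. The chart is regular for $u$ if $\psi^{-1}$ is $C^1$ near $\psi(u)$. $\mathcal{NR}(\mathcal M)$ is the set of points of $\mathcal M$ that have no regular chart. An atlas is a finite collection of local charts whose domains cover $\mathcal M$. For a regular chart $\psi$ for $u$, with inverse $\phi$ and $v=\psi(u)$, the vectors $\partial\phi/\partial v_i(v)$, $i=1,\dots,d$, form a basis of the tangent space $T_u(\mathcal M)\subset\mathbb R^n$. A map $f:\mathcal M\times A\to\mathbb R^j$ ($A\subset\mathbb R^m$ open) is differentiable (resp. $C^1$ near) $(u,x)$, $u\notin\mathcal{NR}(\mathcal M)$, if for every local chart $\psi$ at $u$ whose inverse is differentiable at $\psi(u)$ (resp. $C^1$ near $\psi(u)$) the map $(v,y)\mapsto f(\psi^{-1}(v),y)$ is differentiable at (resp. $C^1$ near) $(\psi(u),x)$. The differential $d_uf(\cdot,x):T_u(\mathcal M)\to\mathbb R^j$ sends $\sum_i w_i\,\partial\phi/\partial v_i(v)$ to $\sum_i w_i\,\partial (f(\phi(\cdot),x))/\partial v_i(v)$; it does not depend on the regular chart. *Degenerate set.* For $X\subset A$ put $$\mathcal{NR}(f)=\{u\in\mathcal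 M\setminus\mathcal{NR}(\mathcal M):\exists x\in A,\ f\text{ is not differentiable at }(u,x)\},$$ $$\mathcal{NS}(f,X)=\{u\in\mathcal M\setminus(\mathcal{NR}(\mathcal M)\cup\mathcal{NR}(f)):\exists x\in X,\ f(u,x)\le 0\text{ and }d_uf(\cdot,x)\text{ is not surjective}\},$$ $$\mathcal D(\mathcal M,X,f)=\mathcal{NR}(\mathcal M)\cup\mathcal{NR}(f)\cup\mathcal{NS}(f,X).$$ **Theorem.** Let $\mathcal M\subset\mathbb R^n$ be a compact $d$-dimensional Lipschitz manifold with a fixed atlas such that at every $u\in\mathcal M\setminus\mathcal{NR}(\mathcal M)$ all charts of the atlas around $u$ are regular for $u$. For each such $u$ let a chart of the atlas around $u$ be chosen, with inverse $\phi_u$, and put $Lip_{\mathcal M}=\sup\{Lip(\phi):\phi^{-1}\text{ is a chart of the atlas}\}$. Let $A\subset\mathbb R^m$ be open, $X\subset A$ a nonempty set with property (CON) with characteristic number $a(X)$, $j\le d$, and ${\bf c}=(c_1,\dots,c_j):\mathcal M\times A\to\mathbb R^j$. Write $\mathcal D=\mathcal D(\mathcal M,X,{\bf c})$ and $U(x)=\{u\in\mathcal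 M:{\bf c}(u,x)\le 0\}$. Assume: 1. $U(x)\neq\emptyset$ for every $x\in X$; 2. $\mathcal D$ is closed; 3. ${\bf c}$ is continuous on $\mathcal M\times A$ and $C^1$ on $(\mathcal M\setminus\mathcal D)\times A$; 4. $\tau:=\sup_{x\in X}\ \sup_{u\in U(x)\setminus\mathcal D}\ \mathcal T(u,x)<\infty$, where $$\mathcal T(u,x)=\max_{\pi\in\Pi(u,x)}\left\|\left(d_u{\bf c}(\cdot,x)\circ T^u_\pi\right)^{-1}\circ d_x{\bf c}(u,\cdot)\right\|.$$ Here, for a multi-index $\pi=(i_1<\dots<i_j)$ in $\{1,\dots,d\}$, $T^u_\pi:\mathbb R^j\to T_u(\mathcal M)$ is the linear map sending the $l$-th canonical basis vector to $\partial\phi_u/\partial v_{i_l}$ at $\phi_u^{-1}(u)$, and $\Pi(u,x)$ is the set of those $\pi$ for which $d_u{\bf c}(\cdot,x)\circ T^u_\pi$ is invertible. Then every $U(x)$, $x\in X$, is compact, and: * **(A)** if $U(x)\cap\mathcal D=\emptyset$ for every $x\in X$, then $$d_H(U(x_1),U(x_2))\le a(X)\,\tau\,Lip_{\mathcal M}\,|x_1-x_2|\qquad\text{for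 all }x_1,x_2\in X;$$ * **(B)** if $\mathcal D\ne\emptyset$ and, for every $x\in X$, every $u\in U(x)\cap\mathcal D$ belongs to the closure of $U(x)\setminus\mathcal D$, then $x\mapsto U(x)$ is $d_H$-uniformly continuous on every compact subset of $X$ that has property (CON). -/

import Mathlib

open Set Filter Topology MeasureTheory
open scoped ENNReal NNReal

noncomputable section

namespace LipControl

/-- Euclidean space `ℝⁿ` with the Euclidean norm. -/
abbrev Euc (n : ℕ) := EuclideanSpace ℝ (Fin n)

/-! ### Regular arcs and the property (CON) -/

/-- `γ : [w₁, w₂] → ℝᵐ` is a regular arc: it is continuous and piecewise differentiable, its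
derivative is bounded, and the derivative does not vanish at any point where it exists. Derivatives
are taken within `[w₁, w₂]`, so they are one-sided at the two end points. -/
structure IsRegularArc {m : ℕ} (γ : ℝ → Euc m) (w₁ w₂ : ℝ) : Prop where
  lt : w₁ < w₂
  continuousOn : ContinuousOn γ (Icc w₁ w₂)
  piecewise : ∃ S : Finset ℝ, ∀ t ∈ Icc w₁ w₂, t ∉ S → DifferentiableWithinAt ℝ γ (Icc w₁ w₂) t
  bounded : ∃ C : ℝ, ∀ t ∈ Icc w₁ w₂, ‖derivWithin γ (Icc w₁ w₂) t‖ ≤ C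
  ne_zero : ∀ t ∈ Icc w₁ w₂, DifferentiableWithinAt ℝ γ (Icc w₁ w₂) t →
    derivWithin γ (Icc w₁ w₂) t ≠ 0

/-- The length `∫ |γ'(t)| dt` of an arc. -/
def arcLength {m : ℕ} (γ : ℝ → Euc m) (w₁ w₂ : ℝ) : ℝ :=
  ∫ t in w₁..w₂, ‖derivWithin γ (Icc w₁ w₂) t‖

/-- `X` has the property (CON) with characteristic number `a`. -/
structure HasCON {m : ℕ} (X : Set (Euc m)) (a : ℝ) : Prop where
  isConnected : IsConnected X
  pos : 0 < a
  exists_arc : ∀ x₁ ∈ X, ∀ x₂ ∈ X, x₁ ≠ x₂ → ∃ (w₁ w₂ : ℝ) (γ : ℝ → Euc m),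
    IsRegularArc γ w₁ w₂ ∧ (∀ t ∈ Icc w₁ w₂, γ t ∈ X) ∧ γ w₁ = x₁ ∧ γ w₂ = x₂ ∧
      arcLength γ w₁ w₂ ≤ a * dist x₁ x₂

/-! ### Lipschitz manifolds in `ℝⁿ` and their charts -/

/-- A local chart `ψ : W → V` of `M ⊆ ℝⁿ`, with `W = ψ.source` open in `M` and `V = ψ.target` open
in `ℝᵈ`: a homeomorphism which is Lipschitz together with its inverse. -/
def IsLipChart {n d : ℕ} {M : Set (Euc n)} (ψ : OpenPartialHomeomorph M (Euc d)) : Prop :=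
  (∃ K : ℝ≥0, LipschitzOnWith K ψ ψ.source) ∧ ∃ K : ℝ≥0, LipschitzOnWith K ψ.symm ψ.target

/-- `M ⊆ ℝⁿ` is a `d`-dimensional Lipschitz manifold. -/
def IsLipManifold {n : ℕ} (M : Set (Euc n)) (d : ℕ) : Prop :=
  ∀ u : M, ∃ ψ : OpenPartialHomeomorph M (Euc d), IsLipChart ψ ∧ u ∈ ψ.source

/-- An atlas: a finite collection of local charts whose domains cover `M`. -/
structure IsAtlas {n d : ℕ} {M : Set (Euc n)} (𝒜 : Set (OpenPartialHomeomorph M (Euc d))) :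
    Prop where
  finite : 𝒜.Finite
  isLipChart : ∀ ψ ∈ 𝒜, IsLipChart ψ
  cover : ∀ u : M, ∃ ψ ∈ 𝒜, u ∈ ψ.source

/-- The inverse `φ` of a chart `ψ`, as a map into the ambient space `ℝⁿ`. Only its values on the
open set `ψ.target` matter. -/
def param {n d : ℕ} {M : Set (Euc n)} (ψ : OpenPartialHomeomorph M (Euc d)) (v : Euc d) : Euc n :=
  (ψ.symm v : Euc n)

/-- `ψ` is a regular chart for `u`: a local chart around `u` whose inverse is `C¹` in a
neighbourhood of `ψ u`. -/
def IsRegularChart {n d : ℕ} {M : Set (Euc n)} (ψ : OpenPartialHomeomorph M (Euc d)) (u : M) :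
    Prop :=
  IsLipChart ψ ∧ u ∈ ψ.source ∧ ContDiffAt ℝ 1 (param ψ) (ψ u)

/-- The set `NR(M)` of nonregular points of the `d`-dimensional Lipschitz manifold `M`. -/
def nonregular {n : ℕ} (M : Set (Euc n)) (d : ℕ) : Set M :=
  {u | ¬ ∃ ψ : OpenPartialHomeomorph M (Euc d), IsRegularChart ψ u}

/-- The Lipschitz constant `sup |f x - f x'| / |x - x'|` of `f` on `s`. -/
def lipConst {α β : Type*} [PseudoEMetricSpace α] [PseudoEMetricSpace β] (f : α → β) (s : Set α) :
    ℝ≥0∞ :=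
  ⨆ (x ∈ s) (x' ∈ s) (_ : x ≠ x'), edist (f x) (f x') / edist x x'

/-- `Lip_M`: the supremum of the Lipschitz constants of the inverses of the charts. -/
def lipAtlas {n d : ℕ} {M : Set (Euc n)} (𝒜 : Set (OpenPartialHomeomorph M (Euc d))) : ℝ≥0∞ :=
  ⨆ ψ ∈ 𝒜, lipConst (param ψ) ψ.target

/-! ### Tangent spaces and differentials at regular points -/

/-- The tangent space `T_u M ⊆ ℝⁿ`, spanned by the vectors `∂φ/∂vᵢ (ψ u)`, where `φ` is the inverse
of a regular chart `ψ` for `u`. -/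
def tangentSpace {n d : ℕ} {M : Set (Euc n)} (ψ : OpenPartialHomeomorph M (Euc d)) (u : M) :
    Submodule ℝ (Euc n) :=
  LinearMap.range (fderiv ℝ (param ψ) (ψ u) : Euc d →ₗ[ℝ] Euc n)

/-- The isomorphism `ℝᵈ → T_u M`, `w ↦ ∑ wᵢ ∂φ/∂vᵢ (ψ u)`. -/
def tangentMap {n d : ℕ} {M : Set (Euc n)} (ψ : OpenPartialHomeomorph M (Euc d)) (u : M) :
    Euc d →ₗ[ℝ] tangentSpace ψ u :=
  (fderiv ℝ (param ψ) (ψ u) : Euc d →ₗ[ℝ] Euc n).rangeRestrict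

/-- The differential `d_u f : T_u M → ℝʲ`, which sends `∑ wᵢ ∂φ/∂vᵢ` to `∑ wᵢ ∂(f ∘ φ)/∂vᵢ`, both
taken at `ψ u`; see `differential_tangentMap`. -/
def differential {n d j : ℕ} {M : Set (Euc n)} (ψ : OpenPartialHomeomorph M (Euc d))
    (f : M → Euc j) (u : M) : tangentSpace ψ u →ₗ[ℝ] Euc j :=
  (fderiv ℝ (fun v => f (ψ.symm v)) (ψ u) : Euc d →ₗ[ℝ] Euc j) ∘ₗ (tangentMap ψ u).leftInverse

theorem tangentMap_ker {n d : ℕ} {M : Set (Euc n)} {ψ : OpenPartialHomeomorph M (Euc d)} {u : M}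
    (h : IsRegularChart ψ u) : LinearMap.ker (tangentMap ψ u) = ⊥ := by
  obtain ⟨⟨⟨K, hK⟩, -⟩, hu, hd⟩ := h
  have hf : HasFDerivAt (param ψ) (fderiv ℝ (param ψ) (ψ u)) (ψ u) :=
    (hd.differentiableAt (by norm_num)).hasFDerivAt
  have hO : (fun v => v - ψ u) =O[𝓝 (ψ u)] fun v => param ψ v - param ψ (ψ u) := by
    refine Asymptotics.IsBigO.of_bound K ?_
    filter_upwards [ψ.open_target.mem_nhds (ψ.map_source hu)] with v hv
    have h1 := hK.dist_le_mul _ (ψ.map_target hv) _ (ψ.map_target (ψ.map_source hu))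
    rw [ψ.right_inv hv, ψ.right_inv (ψ.map_source hu), Subtype.dist_eq] at h1
    simpa [dist_eq_norm, param] using h1
  refine LinearMap.ker_eq_bot'.2 fun w hw => ?_
  have hw' : fderiv ℝ (param ψ) (ψ u) w = 0 := congrArg Subtype.val hw
  have hline : Tendsto (fun t : ℝ => ψ u + t • w) (𝓝 0) (𝓝 (ψ u)) := by
    have : ContinuousAt (fun t : ℝ => ψ u + t • w) 0 := by fun_prop
    simpa [ContinuousAt] using this
  have h2 := (hf.isLittleO.comp_tendsto hline)
  have h3 := hO.comp_tendsto hline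
  simp only [Function.comp_def, add_sub_cancel_left, map_smul, hw', smul_zero, sub_zero] at h2 h3
  have h4 : (fun t : ℝ => t • w) =o[𝓝 0] fun t : ℝ => t • w := h3.trans_isLittleO h2
  have h5 := h4.bound (c := 1 / 2) (by norm_num)
  rw [Metric.eventually_nhds_iff] at h5
  obtain ⟨ε, hε, h5⟩ := h5
  have h6 := h5 (y := ε / 2) (by rw [Real.dist_eq, sub_zero, abs_of_pos (by positivity)]; linarith)
  have h7 : ‖(ε / 2) • w‖ = 0 := le_antisymm (by linarith) (norm_nonneg _)
  rcases smul_eq_zero.1 (norm_eq_zero.1 h7) with h8 | h8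
  · linarith
  · exact h8

theorem differential_tangentMap {n d j : ℕ} {M : Set (Euc n)}
    {ψ : OpenPartialHomeomorph M (Euc d)} {u : M} (h : IsRegularChart ψ u) (f : M → Euc j)
    (w : Euc d) :
    differential ψ f u (tangentMap ψ u w) = fderiv ℝ (fun v => f (ψ.symm v)) (ψ u) w := by
  simp [differential, LinearMap.leftInverse_apply_of_inj (tangentMap_ker h)]

/-! ### Constraints, admissible controls and the degenerate set -/

/-- The set `U(x) = {u ∈ M : c(u, x) ≤ 0}` of admissible controls. -/
def admissible {n m j : ℕ} {M : Set (Euc n)} (c : M → Euc m → Euc j) (x : Euc m) : Set M :=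
  {u | ∀ i, c u x i ≤ 0}

/-- `f` read in the chart `ψ`: the map `(v, x) ↦ f (φ v, x)`. -/
def inChart {n m d j : ℕ} {M : Set (Euc n)} (ψ : OpenPartialHomeomorph M (Euc d))
    (f : M → Euc m → Euc j) (p : Euc d × Euc m) : Euc j :=
  f (ψ.symm p.1) p.2

/-- `f : M × A → ℝʲ` is differentiable at `(u, x)`: so is its expression in every local chart around
`u` whose inverse is differentiable at the image of `u`. -/
def DiffAt {n m j : ℕ} {M : Set (Euc n)} (d : ℕ) (f : M → Euc m → Euc j) (u : M) (x : Euc m) :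
    Prop :=
  ∀ ψ : OpenPartialHomeomorph M (Euc d), IsLipChart ψ → u ∈ ψ.source →
    DifferentiableAt ℝ (param ψ) (ψ u) → DifferentiableAt ℝ (inChart ψ f) (ψ u, x)

/-- `f : M × A → ℝʲ` is `C¹` in a neighbourhood of `(u, x)`: so is its expression in every regular
chart for `u`. -/
def C1At {n m j : ℕ} {M : Set (Euc n)} (d : ℕ) (f : M → Euc m → Euc j) (u : M) (x : Euc m) : Prop :=
  ∀ ψ : OpenPartialHomeomorph M (Euc d), IsRegularChart ψ u →
    ContDiffAt ℝ 1 (inChart ψ f) (ψ u, x)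

/-- The set `NR(f)` of nonregular points of `f : M × A → ℝʲ`. -/
def nonregularFun {n m j : ℕ} {M : Set (Euc n)} (d : ℕ) (A : Set (Euc m)) (f : M → Euc m → Euc j) :
    Set M :=
  {u | u ∉ nonregular M d ∧ ∃ x ∈ A, ¬ DiffAt d f u x}

/-- The set `NS(f, X)` of the points where, for some `x ∈ X`, `f(u, x) ≤ 0` and `d_u f(·, x)` is not
surjective. The surjectivity does not depend on the regular chart in which `d_u f` is computed. -/
def nonsurjective {n m j : ℕ} {M : Set (Euc n)} (d : ℕ) (A X : Set (Euc m))
    (f : M → Euc m → Euc j) : Set M :=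
  {u | u ∉ nonregular M d ∪ nonregularFun d A f ∧ ∃ x ∈ X, u ∈ admissible f x ∧
    ∃ ψ : OpenPartialHomeomorph M (Euc d), IsRegularChart ψ u ∧
      ¬ Function.Surjective (differential ψ (fun u' => f u' x) u)}

/-- The degenerate set `D(M, X, f) = NR(M) ∪ NR(f) ∪ NS(f, X)`. -/
def degenerate {n m j : ℕ} {M : Set (Euc n)} (d : ℕ) (A X : Set (Euc m)) (f : M → Euc m → Euc j) :
    Set M :=
  nonregular M d ∪ nonregularFun d A f ∪ nonsurjective d A X f

/-! ### The bound `τ` on the implicit derivatives -/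

/-- The map `T_π : ℝʲ → ℝᵈ` with matrix entries `1` at `(π l, l)` and `0` elsewhere, for a
multi-index `π = (π 0 < π 1 < ⋯)`. -/
def coordInclusion {d j : ℕ} (π : Fin j ↪o Fin d) : Euc j →ₗ[ℝ] Euc d :=
  Matrix.toEuclideanLin (Matrix.of fun h l => if h = π l then (1 : ℝ) else 0)

/-- The map `T^u_π : ℝʲ → T_u M`, with matrix `T_π` in the canonical basis of `ℝʲ` and the basis
`∂φ/∂vᵢ` of `T_u M`. -/
def tangentInclusion {n d j : ℕ} {M : Set (Euc n)} (ψ : OpenPartialHomeomorph M (Euc d)) (u : M)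
    (π : Fin j ↪o Fin d) : Euc j →ₗ[ℝ] tangentSpace ψ u :=
  tangentMap ψ u ∘ₗ coordInclusion π

/-- The operator `d_u c(·, x) ∘ T^u_π` on `ℝʲ`. -/
def controlJacobian {n m d j : ℕ} {M : Set (Euc n)} (ψ : OpenPartialHomeomorph M (Euc d))
    (c : M → Euc m → Euc j) (u : M) (x : Euc m) (π : Fin j ↪o Fin d) : Euc j →L[ℝ] Euc j :=
  (differential ψ (fun u' => c u' x) u ∘ₗ tangentInclusion ψ u π).toContinuousLinearMap

/-- `𝒯(u, x)`: the maximum, over the multi-indices `π` for which `d_u c(·, x) ∘ T^u_π` is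
invertible, of the operator norm of `(d_u c(·, x) ∘ T^u_π)⁻¹ ∘ d_x c(u, ·)`. -/
def implicitNorm {n m d j : ℕ} {M : Set (Euc n)} (ψ : OpenPartialHomeomorph M (Euc d))
    (c : M → Euc m → Euc j) (u : M) (x : Euc m) : ℝ≥0∞ :=
  ⨆ (π : Fin j ↪o Fin d) (_ : (controlJacobian ψ c u x π).IsInvertible),
    ‖(controlJacobian ψ c u x π).inverse ∘L fderiv ℝ (c u) x‖ₑ

/-- `τ`: the supremum of `𝒯(u, x)` over `x ∈ X` and the nondegenerate `u ∈ U(x)`, where `chart u` is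
the regular chart chosen for `u`. -/
def tau {n m d j : ℕ} {M : Set (Euc n)} (A X : Set (Euc m)) (c : M → Euc m → Euc j)
    (chart : M → OpenPartialHomeomorph M (Euc d)) : ℝ≥0∞ :=
  ⨆ (x ∈ X) (u ∈ admissible c x \ degenerate d A X c), implicitNorm (chart u) c u x

end LipControl

end

namespace LipControl

/-! At a nondegenerate admissible `u` for `x`, the differential of `c(·, x)` is surjective, so some
`j` chart coordinates give an invertible block. With the other coordinates frozen, the implicit
function theorem solves `c(·, y) = c(u, x)` for `y` near `x`. Keeping the value of `c` keeps the
inequality `c ≤ 0`, whichever constraints are active. The solution has derivative `-(d_u c ∘ T_π)⁻¹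
∘ d_x c`, of norm at most `τ`; including the `j` coordinates in `ℝᵈ` is isometric, and returning to
`M` costs at most `Lip_M`. This is `eventually_exists_lift`.

(A) The neighbourhood of `x` obtained depends on `u`, so the bound is propagated along an arc by
continuous induction (`exists_mem_dist_le_of_local`): for `k > τ`, the times reachable with
displacement at most `Lip_M * k` times the arc length form a closed set, because `M` is compact, and
each such time can be passed to the right. (CON) bounds the length, and `k` decreases to `τ`.

(B) Lifting gives lower semicontinuity of `U` at nondegenerate controls, and density extends it to
all of `U(x)`. Closed graph and compactness of `M` give upper semicontinuity; continuity on a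
compact set is then uniform. -/

/-! ### Lipschitz constants of charts -/

theorem edist_le_lipConst_mul {α β : Type*} [EMetricSpace α] [PseudoEMetricSpace β] (f : α → β)
    {s : Set α} {x y : α} (hx : x ∈ s) (hy : y ∈ s) (hxy : edist x y ≠ ⊤) :
    edist (f x) (f y) ≤ lipConst f s * edist x y := by
  rcases eq_or_ne x y with rfl | h
  · simp
  · rw [← ENNReal.div_le_iff (edist_pos.2 h).ne' hxy]
    exact le_iSup₂_of_le x hx (le_iSup₂_of_le y hy (le_iSup_of_le h le_rfl))

theorem lipConst_le {α β : Type*} [EMetricSpace α] [PseudoEMetricSpace β] {f : α → β}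
    {s : Set α} {K : ℝ≥0} (h : LipschitzOnWith K f s) : lipConst f s ≤ K := by
  refine iSup₂_le fun x hx => iSup₂_le fun y hy => iSup_le fun hxy => ?_
  exact ENNReal.div_le_of_le_mul (h hx hy)

theorem lipConst_param_lt_top {n d : ℕ} {M : Set (Euc n)} {ψ : OpenPartialHomeomorph M (Euc d)}
    (h : IsLipChart ψ) : lipConst (param ψ) ψ.target < ⊤ := by
  obtain ⟨-, K, hK⟩ := h
  refine (lipConst_le (K := K) fun x hx y hy => ?_).trans_lt ENNReal.coe_lt_top
  exact hK hx hy

theorem lipAtlas_lt_top {n d : ℕ} {M : Set (Euc n)} {𝒜 : Set (OpenPartialHomeomorph M (Euc d))}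
    (h : IsAtlas 𝒜) : lipAtlas 𝒜 < ⊤ := by
  unfold lipAtlas
  have : ⨆ ψ ∈ 𝒜, lipConst (param ψ) ψ.target
      ≤ ∑ ψ ∈ h.finite.toFinset, lipConst (param ψ) ψ.target :=
    iSup₂_le fun ψ hψ => Finset.single_le_sum (f := fun ψ => lipConst (param ψ) ψ.target)
      (fun _ _ => zero_le) (h.finite.mem_toFinset.2 hψ)
  refine this.trans_lt (ENNReal.sum_lt_top.2 fun ψ hψ => ?_)
  exact lipConst_param_lt_top (h.isLipChart ψ (h.finite.mem_toFinset.1 hψ))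

/-! ### Coordinate inclusions and invertible blocks -/

theorem coordInclusion_apply {d j : ℕ} (π : Fin j ↪o Fin d) (w : Euc j) :
    coordInclusion π w = ∑ l, w l • EuclideanSpace.single (π l) (1 : ℝ) := by
  ext h
  simp [coordInclusion, Matrix.mulVec, dotProduct, Pi.single_apply, Finset.sum_apply, mul_comm]

/-- Distinct canonical basis vectors are orthonormal. Hence passing from `ℝʲ` to the chart domain
adds no constant to the final estimate. -/
theorem norm_coordInclusion {d j : ℕ} (π : Fin j ↪o Fin d) (w : Euc j) :
    ‖coordInclusion π w‖ = ‖w‖ := by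
  have ho : Orthonormal ℝ fun l => EuclideanSpace.single (π l) (1 : ℝ) :=
    (EuclideanSpace.orthonormal_single (𝕜 := ℝ) (ι := Fin d)).comp π π.injective
  rw [← sq_eq_sq₀ (norm_nonneg _) (norm_nonneg _), coordInclusion_apply,
    ← real_inner_self_eq_norm_sq, ho.inner_sum, EuclideanSpace.real_norm_sq_eq]
  simp [sq]

/-- The columns of a surjective map onto `ℝʲ` span, so `j` of them form a basis; their indices,
sorted increasingly, are the multi-index. -/
theorem exists_isInvertible_controlJacobian {n m d j : ℕ} {M : Set (Euc n)}
    (ψ : OpenPartialHomeomorph M (Euc d)) (c : M → Euc m → Euc j) (u : M) (x : Euc m)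
    (h : Function.Surjective (differential ψ (fun u' => c u' x) u)) :
    ∃ π : Fin j ↪o Fin d, (controlJacobian ψ c u x π).IsInvertible := by
  set L : Euc d →ₗ[ℝ] Euc j := differential ψ (fun u' => c u' x) u ∘ₗ tangentMap ψ u
  have hLs : Function.Surjective L :=
    h.comp (LinearMap.surjective_rangeRestrict (fderiv ℝ (param ψ) (ψ u) : Euc d →ₗ[ℝ] Euc n))
  set v : Fin d → Euc j := fun i => L (EuclideanSpace.single i 1)
  have hv : Submodule.span ℝ (range v) = ⊤ := by
    have := (EuclideanSpace.basisFun (Fin d) ℝ).toBasis.span_eq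
    rw [← LinearMap.range_eq_top.2 hLs, LinearMap.range_eq_map, ← this, Submodule.map_span,
      ← range_comp]
    congr 2
    ext1 i
    simp [v]
  obtain ⟨κ, e, he, hspan, hli⟩ := exists_linearIndependent' ℝ v
  have : Fintype κ := Fintype.ofInjective e he
  have hcard : Fintype.card κ = j := by
    have := Module.finrank_eq_card_basis
      (Module.Basis.mk hli (by rw [hspan, hv]))
    simpa using this.symm
  let s : Finset (Fin d) := Finset.univ.map ⟨e, he⟩
  have hs : s.card = j := by simp [s, hcard]
  let π : Fin j ↪o Fin d := s.orderEmbOfFin hs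
  have hπ : ∀ l, ∃ k, e k = π l := fun l => by
    obtain ⟨k, -, hk⟩ := Finset.mem_map.1 (s.orderEmbOfFin_mem hs l)
    exact ⟨k, hk⟩
  choose k hk using hπ
  have hkinj : Function.Injective k := fun a b hab => π.injective (by rw [← hk, ← hk, hab])
  have hli' := hli.comp k hkinj
  refine ⟨π, ?_⟩
  have hinj : Function.Injective
      (differential ψ (fun u' => c u' x) u ∘ₗ tangentInclusion ψ u π) := by
    refine (injective_iff_map_eq_zero _).2 fun w hw => ?_
    have hw' : ∑ l, w l • (v ∘ e ∘ k) l = 0 := by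
      rw [← hw]
      change _ = L (coordInclusion π w)
      simp [coordInclusion_apply, v, hk]
    ext l
    exact Fintype.linearIndependent_iff.1 hli' w hw' l
  -- An injective endomorphism of the finite-dimensional `ℝʲ` is invertible.
  refine ⟨(LinearEquiv.ofInjectiveEndo _ hinj).toContinuousLinearEquiv, ?_⟩
  ext1 w
  rfl

theorem controlJacobian_apply {n m d j : ℕ} {M : Set (Euc n)}
    {ψ : OpenPartialHomeomorph M (Euc d)} {u : M} (h : IsRegularChart ψ u)
    (c : M → Euc m → Euc j) (x : Euc m) (π : Fin j ↪o Fin d) (w : Euc j) :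
    controlJacobian ψ c u x π w =
      fderiv ℝ (fun v => c (ψ.symm v) x) (ψ u) (coordInclusion π w) :=
  differential_tangentMap h (fun u' => c u' x) _

/-! ### Local solutions by the implicit function theorem -/

/-- Near `x`, the equation `c(·, y) = c(u, x)` has a solution whose distance to `u` is controlled by
the norm of the implicit derivative. -/
theorem eventually_exists_lift {n m d j : ℕ} {M : Set (Euc n)}
    {ψ : OpenPartialHomeomorph M (Euc d)} {u : M} (hψ : IsRegularChart ψ u)
    {c : M → Euc m → Euc j} {x : Euc m} (hc : C1At d c u x) {π : Fin j ↪o Fin d}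
    (hπ : (controlJacobian ψ c u x π).IsInvertible) {K : ℝ≥0}
    (hK : ‖(controlJacobian ψ c u x π).inverse ∘L fderiv ℝ (c u) x‖ₑ < K) :
    ∀ᶠ y in 𝓝 x, ∃ u' : M, c u' y = c u x ∧
      edist u u' ≤ lipConst (param ψ) ψ.target * (K * edist x y) := by
  set T : Euc j →L[ℝ] Euc d := (coordInclusion π).toContinuousLinearMap
  have hG : HasStrictFDerivAt (inChart ψ c) (fderiv ℝ (inChart ψ c) (ψ u, x)) (ψ u, x) :=
    (hc ψ hψ).hasStrictFDerivAt (by norm_num)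
  set G' := fderiv ℝ (inChart ψ c) (ψ u, x)
  have hu : ψ.symm (ψ u) = u := ψ.left_inv hψ.2.1
  have hv : fderiv ℝ (fun v => c (ψ.symm v) x) (ψ u) = G' ∘L .inl ℝ _ _ :=
    (HasFDerivAt.comp (ψ u) (g := inChart ψ c) hG.hasFDerivAt
      (hasFDerivAt_prodMk_left (𝕜 := ℝ) (ψ u) x)).fderiv
  have hx : fderiv ℝ (c u) x = G' ∘L .inr ℝ _ _ := by
    have := (HasFDerivAt.comp x (g := inChart ψ c) hG.hasFDerivAt
      (hasFDerivAt_prodMk_right (𝕜 := ℝ) (ψ u) x)).fderiv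
    rw [← this]
    congr 1
    ext1 y
    simp [inChart, hu]
  -- Only the coordinates selected by `π` move, and the parameter comes first, so the unknown is the
  -- second factor: the two blocks of `G' ∘L ι` are then `d_x c` and the control Jacobian.
  let ι : Euc m × Euc j →L[ℝ] Euc d × Euc m :=
    (T ∘L .snd ℝ _ _).prod (.fst ℝ _ _)
  have hι : HasStrictFDerivAt (fun p : Euc m × Euc j => (ψ u + T p.2, p.1)) ι (x, 0) :=
    ((T ∘L .snd ℝ (Euc m) (Euc j)).hasStrictFDerivAt.const_add (ψ u)).prodMk hasStrictFDerivAt_fst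
  have hF : HasStrictFDerivAt (fun p : Euc m × Euc j => inChart ψ c (ψ u + T p.2, p.1)) (G' ∘L ι)
      (x, 0) :=
    HasStrictFDerivAt.comp (g := inChart ψ c) (x, 0) (by simpa using hG) hι
  have hr : (G' ∘L ι) ∘L .inr ℝ _ _ = controlJacobian ψ c u x π := by
    ext1 w
    rw [controlJacobian_apply hψ, hv]
    simp [ι, T]
  have hl : (G' ∘L ι) ∘L .inl ℝ _ _ = fderiv ℝ (c u) x := by
    ext1 w
    rw [hx]
    simp [ι]
  have hinv : ((G' ∘L ι) ∘L .inr ℝ _ _).IsInvertible := hr ▸ hπ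
  set g := hF.implicitFunctionOfProdDomain hinv
  have hg := hF.hasStrictFDerivAt_implicitFunctionOfProdDomain hinv
  have hg0 : g x = 0 := (hF.eventually_apply_eq_iff_implicitFunctionOfProdDomain hinv).self_of_nhds.1
    rfl
  have hgt : Tendsto g (𝓝 x) (𝓝 0) := hF.tendsto_implicitFunctionOfProdDomain hinv
  have hgc := hF.eventually_apply_implicitFunctionOfProdDomain hinv
  rw [hr, hl] at hg
  -- Strict differentiability turns the strict bound on the derivative into a Lipschitz bound with
  -- constant exactly `K` near `x`.
  have hlip : ∀ᶠ y in 𝓝 x, ‖g y - g x‖ ≤ K * ‖y - x‖ := by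
    obtain ⟨s, hs, hK⟩ := hg.exists_lipschitzOnWith_of_nnnorm_lt K (by
      rw [nnnorm_neg]
      exact ENNReal.coe_lt_coe.1 hK)
    filter_upwards [hs] with y hy
    exact hK.norm_sub_le hy (mem_of_mem_nhds hs)
  have htar : ∀ᶠ y in 𝓝 x, ψ u + T (g y) ∈ ψ.target := by
    have : Tendsto (fun y => ψ u + T (g y)) (𝓝 x) (𝓝 (ψ u + T 0)) :=
      tendsto_const_nhds.add ((T.continuous.tendsto 0).comp hgt)
    rw [map_zero, add_zero] at this
    exact this (ψ.open_target.mem_nhds (ψ.map_source hψ.2.1))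
  filter_upwards [hlip, htar, hgc] with y hy hty hcy
  refine ⟨ψ.symm (ψ u + T (g y)), ?_, ?_⟩
  · have : c (ψ.symm (ψ u + T (g y))) y = c (ψ.symm (ψ u + T 0)) x := hcy
    rwa [map_zero, add_zero, hu] at this
  · have h1 := edist_le_lipConst_mul (param ψ) (ψ.map_source hψ.2.1) hty (edist_ne_top _ _)
    have h2 : edist (param ψ (ψ u)) (param ψ (ψ u + T (g y))) =
        edist u (ψ.symm (ψ u + T (g y))) := by
      rw [Subtype.edist_eq, param, param, hu]
    rw [← h2]
    refine h1.trans ?_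
    gcongr
    rw [edist_comm x, edist_eq_enorm_sub, edist_eq_enorm_sub, ← enorm_neg]
    have h3 : ‖T (g y)‖ ≤ K * ‖y - x‖ := by
      rw [hg0, sub_zero] at hy
      exact (norm_coordInclusion π _).trans_le hy
    have h4 := ENNReal.ofReal_le_ofReal h3
    rw [ENNReal.ofReal_mul K.coe_nonneg, ofReal_norm, ofReal_norm, ENNReal.ofReal_coe_nnreal] at h4
    simpa using h4

/-! ### Length of regular arcs -/

/-- Inside the interval the one-sided derivative agrees with `deriv γ`, which is measurable for any
`γ`; boundedness then suffices on a set of finite measure. -/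
theorem IsRegularArc.integrableOn_derivWithin {m : ℕ} {γ : ℝ → Euc m} {w₁ w₂ : ℝ}
    (h : IsRegularArc γ w₁ w₂) :
    IntegrableOn (fun t => derivWithin γ (Icc w₁ w₂) t) (Icc w₁ w₂) := by
  obtain ⟨C, hC⟩ := h.bounded
  rw [integrableOn_Icc_iff_integrableOn_Ioo]
  refine IntegrableOn.congr_fun (f := deriv γ) ?_
    (fun t ht => (derivWithin_of_mem_nhds (Icc_mem_nhds ht.1 ht.2)).symm) measurableSet_Ioo
  refine Measure.integrableOn_of_bounded (M := C) (by simp) (aestronglyMeasurable_deriv γ volume) ?_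
  filter_upwards [ae_restrict_mem measurableSet_Ioo] with t ht
  rw [← derivWithin_of_mem_nhds (Icc_mem_nhds ht.1 ht.2)]
  exact hC t (Ioo_subset_Icc_self ht)

theorem IsRegularArc.intervalIntegrable_derivWithin {m : ℕ} {γ : ℝ → Euc m} {w₁ w₂ : ℝ}
    (h : IsRegularArc γ w₁ w₂) {s t : ℝ} (hs : s ∈ Icc w₁ w₂) (ht : t ∈ Icc w₁ w₂) :
    IntervalIntegrable (fun t => derivWithin γ (Icc w₁ w₂) t) volume s t :=
  (h.integrableOn_derivWithin.mono_set (uIcc_subset_Icc hs ht)).intervalIntegrable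

/-- The increment of a regular arc is bounded by the length of the arc in between. -/
theorem IsRegularArc.norm_sub_le {m : ℕ} {γ : ℝ → Euc m} {w₁ w₂ : ℝ}
    (h : IsRegularArc γ w₁ w₂) {s t : ℝ} (hs : s ∈ Icc w₁ w₂) (ht : t ∈ Icc w₁ w₂) (hst : s ≤ t) :
    ‖γ t - γ s‖ ≤ ∫ r in s..t, ‖derivWithin γ (Icc w₁ w₂) r‖ := by
  obtain ⟨S, hS⟩ := h.piecewise
  -- The fundamental theorem of calculus tolerates the finite exceptional set because `γ` is
  -- continuous.
  have hint := integral_eq_of_hasDerivAt_off_countable γ (fun r => derivWithin γ (Icc w₁ w₂) r)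
    S.countable_toSet (h.continuousOn.mono (uIcc_subset_Icc hs ht)) (fun r hr => ?_)
    (h.intervalIntegrable_derivWithin hs ht)
  · rw [← hint]
    exact intervalIntegral.norm_integral_le_integral_norm hst
  · rw [min_eq_left hst, max_eq_right hst] at hr
    have h1 : r ∈ Ioo w₁ w₂ := ⟨hs.1.trans_lt hr.1.1, hr.1.2.trans_le ht.2⟩
    exact (hS r (Ioo_subset_Icc_self h1) hr.2).hasDerivWithinAt.hasDerivAt (Icc_mem_nhds h1.1 h1.2)

/-! ### Set-valued maps with closed graph -/

/-- Continuous induction for a set-valued map with closed graph: a local one-sided bound on the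
distance to the next value, given by the increments of `s`, propagates to the whole interval. -/
theorem exists_mem_dist_le_of_local {E : Type*} [MetricSpace E] [CompactSpace E] {U : ℝ → Set E}
    {s : ℝ → ℝ} {a b : ℝ} (hab : a ≤ b) (hs : ContinuousOn s (Icc a b))
    (hU : IsClosed {p : ℝ × E | p.1 ∈ Icc a b ∧ p.2 ∈ U p.1})
    (hstep : ∀ t ∈ Ico a b, ∀ u ∈ U t, ∀ᶠ t' in 𝓝[>] t, ∃ u' ∈ U t', dist u u' ≤ s t' - s t)
    {u : E} (hu : u ∈ U a) : ∃ u' ∈ U b, dist u u' ≤ s b - s a := by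
  set S : Set ℝ := {t | ∃ u' ∈ U t, dist u u' ≤ s t - s a}
  suffices h : Icc a b ⊆ S from h (right_mem_Icc.2 hab)
  refine IsClosed.Icc_subset_of_forall_mem_nhdsWithin ?_ ⟨u, hu, by simp⟩ ?_
  · set C := {p : ℝ × E | p.1 ∈ Icc a b ∧ p.2 ∈ U p.1}
    have hf : ContinuousOn (fun p : ℝ × E => s p.1 - s a - dist u p.2) C :=
      ((hs.comp continuousOn_fst fun p hp => hp.1).sub continuousOn_const).sub
        (continuous_const.dist continuous_snd).continuousOn
    -- The good times are the projection of the graph points where the slack `s t - s a - dist u u'`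
    -- is nonnegative. This set is compact, so its projection is closed.
    have hcl := hf.preimage_isClosed_of_isClosed hU (isClosed_Ici (a := (0 : ℝ)))
    have hcpt : IsCompact (C ∩ (fun p : ℝ × E => s p.1 - s a - dist u p.2) ⁻¹' Ici 0) :=
      (isCompact_Icc.prod isCompact_univ).of_isClosed_subset hcl fun p hp => ⟨hp.1.1, mem_univ _⟩
    convert (hcpt.image continuous_fst).isClosed using 1
    ext t
    constructor
    · rintro ⟨⟨u', hu', hd⟩, ht⟩
      exact ⟨(t, u'), ⟨⟨ht, hu'⟩, sub_nonneg.2 hd⟩, rfl⟩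
    · rintro ⟨⟨t, u'⟩, ⟨⟨ht, hu'⟩, hd⟩, rfl⟩
      exact ⟨⟨u', hu', sub_nonneg.1 hd⟩, ht⟩
  · rintro t ⟨⟨u', hu', hd⟩, ht⟩
    filter_upwards [hstep t ht u' hu'] with t' ⟨u'', hu'', hd'⟩
    exact ⟨u'', hu'', by linarith [dist_triangle u u' u'']⟩

/-- A set-valued map with closed graph and compact range space that is lower semicontinuous on a
compact set is uniformly continuous there for the Hausdorff distance. -/
theorem hausdorffDist_uniform_of_lowerSemicontinuous {E Y : Type*} [MetricSpace E] [CompactSpace E]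
    [MetricSpace Y] {U : Y → Set E} {K : Set Y} (hK : IsCompact K)
    (hU : IsClosed {p : Y × E | p.1 ∈ K ∧ p.2 ∈ U p.1}) (hne : ∀ x ∈ K, (U x).Nonempty)
    (hlow : ∀ x ∈ K, ∀ u ∈ U x, ∀ ε > 0, ∀ᶠ y in 𝓝[K] x, ∃ u' ∈ U y, dist u u' < ε) :
    ∀ ε > 0, ∃ δ > 0, ∀ x ∈ K, ∀ y ∈ K, dist x y < δ → Metric.hausdorffDist (U x) (U y) < ε := by
  have hclosed : ∀ x ∈ K, IsClosed (U x) := fun x hx => by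
    convert hU.preimage (Continuous.prodMk_right x) using 1
    ext u
    simp [hx]
  -- The metric on `NonemptyCompacts` is the Hausdorff distance, so the claim becomes uniform
  -- continuity of `F` on the compact space `K`.
  let F : K → TopologicalSpace.NonemptyCompacts E := fun x =>
    ⟨⟨U x, (hclosed x x.2).isCompact⟩, hne x x.2⟩
  have hcont : ∀ x ∈ K, ∀ ε > 0, ∀ᶠ y in 𝓝[K] x, Metric.hausdorffDist (U y) (U x) ≤ ε := by
    intro x hx ε hε
    have hup : ∀ᶠ y in 𝓝[K] x, ∀ u' ∈ U y, ∃ u ∈ U x, dist u' u ≤ ε := by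
      -- Graph points at distance at least `ε` from `U x`: a compact set whose projection is closed
      -- and misses `x`, hence misses a neighbourhood of `x`.
      set C := {p : Y × E | p.1 ∈ K ∧ p.2 ∈ U p.1} ∩ {p | ε ≤ Metric.infDist p.2 (U x)}
      have hC : IsCompact C := (hK.prod isCompact_univ).of_isClosed_subset
        (hU.inter (isClosed_le continuous_const
          ((Metric.continuous_infDist_pt (U x)).comp continuous_snd)))
        fun p hp => ⟨hp.1.1, mem_univ _⟩
      have hxC : x ∉ Prod.fst '' C := by
        rintro ⟨⟨x, u⟩, ⟨⟨-, hu⟩, hle⟩, rfl⟩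
        have : Metric.infDist u (U x) = 0 := Metric.infDist_zero_of_mem hu
        exact absurd hle (by simpa [this] using hε)
      filter_upwards [mem_nhdsWithin_of_mem_nhds
        ((hC.image continuous_fst).isClosed.isOpen_compl.mem_nhds hxC), self_mem_nhdsWithin]
        with y hy hyK u' hu'
      have : Metric.infDist u' (U x) < ε :=
        not_le.1 fun hle => hy ⟨(y, u'), ⟨⟨hyK, hu'⟩, hle⟩, rfl⟩
      obtain ⟨u, hu, hd⟩ := (Metric.infDist_lt_iff (hne x hx)).1 this
      exact ⟨u, hu, hd.le⟩
    have hlo : ∀ᶠ y in 𝓝[K] x, ∀ u ∈ U x, ∃ u' ∈ U y, dist u u' ≤ ε := by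
      -- A finite `ε / 2`-net of `U x` makes the pointwise lower semicontinuity uniform in `u`.
      obtain ⟨t, ht, htf, hcov⟩ := (hclosed x hx).isCompact.finite_cover_balls (half_pos hε)
      have := (eventually_all_finite htf).2 fun v hv => hlow x hx v (ht hv) (ε / 2) (half_pos hε)
      filter_upwards [this] with y hy u hu
      obtain ⟨v, hv, huv⟩ := mem_iUnion₂.1 (hcov hu)
      obtain ⟨u', hu', hd⟩ := hy v hv
      exact ⟨u', hu', by linarith [dist_triangle u v u', Metric.mem_ball.1 huv]⟩
    filter_upwards [hup, hlo] with y h1 h2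
    exact Metric.hausdorffDist_le_of_mem_dist hε.le h1 h2
  have hF : Continuous F := continuous_iff_continuousAt.2 fun x => by
    refine Metric.tendsto_nhds.2 fun ε hε => ?_
    have := hcont x x.2 (ε / 2) (half_pos hε)
    rw [nhdsWithin_eq_map_subtype_coe x.2, eventually_map] at this
    filter_upwards [this] with y hy
    exact lt_of_le_of_lt hy (half_lt_self hε)
  have : CompactSpace K := isCompact_iff_compactSpace.1 hK
  intro ε hε
  obtain ⟨δ, hδ, h⟩ := Metric.uniformContinuous_iff.1
    (CompactSpace.uniformContinuous_of_continuous hF) ε hε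
  exact ⟨δ, hδ, fun x hx y hy hxy => h (a := ⟨x, hx⟩) (b := ⟨y, hy⟩) hxy⟩

/-! ### Continuity of the admissible controls -/

/-- The parametrisation `γ` is left free to serve three uses: the identity for (B), an arc for (A),
a constant for the compactness of one `U(x)`. -/
theorem isClosed_setOf_mem_admissible {n m j : ℕ} {M : Set (Euc n)} {A : Set (Euc m)}
    {c : M → Euc m → Euc j} (hc : ContinuousOn (fun p : M × Euc m => c p.1 p.2) (univ ×ˢ A))
    {Y : Type*} [TopologicalSpace Y] {K : Set Y} (hK : IsClosed K) {γ : Y → Euc m}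
    (hγ : ContinuousOn γ K) (hA : MapsTo γ K A) :
    IsClosed {p : Y × M | p.1 ∈ K ∧ p.2 ∈ admissible c (γ p.1)} := by
  have hf : ContinuousOn (fun p : Y × M => c p.2 (γ p.1)) (K ×ˢ univ) :=
    hc.comp (continuousOn_snd.prodMk (hγ.comp continuousOn_fst fun p hp => hp.1))
      fun p hp => ⟨mem_univ _, hA hp.1⟩
  have hle : IsClosed {z : Euc j | ∀ i, z i ≤ 0} := by
    simp only [ofPred_forall]
    exact isClosed_iInter fun i => isClosed_le (by fun_prop) continuous_const
  convert hf.preimage_isClosed_of_isClosed (hK.prod isClosed_univ) hle using 1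
  ext p
  simp [admissible]

theorem exists_isInvertible_of_notMem_degenerate {n m d j : ℕ} {M : Set (Euc n)} {A X : Set (Euc m)}
    {c : M → Euc m → Euc j} {x : Euc m} {u : M} {ψ : OpenPartialHomeomorph M (Euc d)}
    (hψ : IsRegularChart ψ u) (hu : u ∉ degenerate d A X c) (hx : x ∈ X)
    (hux : u ∈ admissible c x) :
    ∃ π : Fin j ↪o Fin d, (controlJacobian ψ c u x π).IsInvertible := by
  refine exists_isInvertible_controlJacobian ψ c u x ?_
  by_contra hns
  exact hu (Or.inr ⟨fun h => hu (Or.inl h), x, hx, hux, ψ, hψ, hns⟩)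

theorem admissible_of_eq {n m j : ℕ} {M : Set (Euc n)} {c : M → Euc m → Euc j} {x y : Euc m}
    {u u' : M} (h : c u' y = c u x) (hu : u ∈ admissible c x) : u' ∈ admissible c y :=
  fun i => by rw [h]; exact hu i

/-- If the nondegenerate admissible controls are dense among the admissible ones, the set of
admissible controls is uniformly continuous on compact sets of parameters. -/
theorem hausdorffDist_admissible_uniform {n m d j : ℕ} {M : Set (Euc n)} (hM : IsCompact M) {A X K : Set (Euc m)}
    (hXA : X ⊆ A) {c : M → Euc m → Euc j}
    (hU : ∀ x ∈ X, (admissible c x).Nonempty)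
    (hc : ContinuousOn (fun p : M × Euc m => c p.1 p.2) (Set.univ ×ˢ A))
    (hc1 : ∀ u ∉ degenerate d A X c, ∀ x ∈ A, C1At d c u x)
    (hcl : ∀ x ∈ X, ∀ u ∈ admissible c x ∩ degenerate d A X c,
      u ∈ closure (admissible c x \ degenerate d A X c))
    (hKX : K ⊆ X) (hK : IsCompact K) :
    ∀ ε > 0, ∃ δ > 0, ∀ x ∈ K, ∀ y ∈ K, dist x y < δ →
      Metric.hausdorffDist (admissible c x) (admissible c y) < ε := by
  have : CompactSpace M := isCompact_iff_compactSpace.1 hM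
  refine hausdorffDist_uniform_of_lowerSemicontinuous hK
    (isClosed_setOf_mem_admissible hc hK.isClosed continuousOn_id fun x hx => hXA (hKX hx))
    (fun x hx => hU x (hKX hx)) fun x hx u hu ε hε => ?_
  have hu' : u ∈ closure (admissible c x \ degenerate d A X c) := by
    by_cases h : u ∈ degenerate d A X c
    · exact hcl x (hKX hx) u ⟨hu, h⟩
    · exact subset_closure ⟨hu, h⟩
  obtain ⟨v, ⟨hv, hvD⟩, huv⟩ := Metric.mem_closure_iff.1 hu' (ε / 2) (half_pos hε)
  obtain ⟨ψ, hψ⟩ : ∃ ψ : OpenPartialHomeomorph M (Euc d), IsRegularChart ψ v :=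
    not_not.1 fun h => hvD (Or.inl (Or.inl h))
  obtain ⟨π, hπ⟩ := exists_isInvertible_of_notMem_degenerate hψ hvD (hKX hx) hv
  -- Lower semicontinuity at `x` is qualitative, so any finite `k` above the norm at this `v` will
  -- do.
  obtain ⟨k, hk⟩ := ENNReal.lt_iff_exists_nnreal_btwn.1
    (enorm_lt_top (x := (controlJacobian ψ c v x π).inverse ∘L fderiv ℝ (c v) x))
  have hlift := eventually_exists_lift hψ (hc1 v hvD x (hXA (hKX hx))) hπ hk.1
  have htend : Tendsto (fun y => lipConst (param ψ) ψ.target * (k * edist x y)) (𝓝 x) (𝓝 0) := by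
    have h1 : Tendsto (fun y => edist x y) (𝓝 x) (𝓝 (edist x x)) :=
      (continuous_const.edist continuous_id).tendsto x
    rw [edist_self] at h1
    have h2 := ENNReal.Tendsto.const_mul (ENNReal.Tendsto.const_mul h1
      (Or.inr (ENNReal.coe_ne_top (r := k)))) (Or.inr (lipConst_param_lt_top hψ.1).ne)
    simpa using h2
  have hsmall := htend.eventually (gt_mem_nhds (ENNReal.ofReal_pos.2 (half_pos hε)))
  filter_upwards [mem_nhdsWithin_of_mem_nhds hlift, mem_nhdsWithin_of_mem_nhds hsmall]
    with y ⟨u', hcu, hd⟩ hy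
  refine ⟨u', admissible_of_eq hcu hv, ?_⟩
  have : dist v u' < ε / 2 := by
    rw [← edist_lt_ofReal]
    exact hd.trans_lt hy
  linarith [dist_triangle u v u']

/-- Along a regular arc of nondegenerate parameters, admissible controls move at a speed bounded by
the implicit derivative. -/
theorem infEDist_admissible_le {n m d j : ℕ} {M : Set (Euc n)} (hM : IsCompact M)
    {𝒜 : Set (OpenPartialHomeomorph M (Euc d))} (h𝒜 : IsAtlas 𝒜)
    (h𝒜reg : ∀ u : M, u ∉ nonregular M d → ∀ ψ ∈ 𝒜, u ∈ ψ.source → IsRegularChart ψ u)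
    {chart : M → OpenPartialHomeomorph M (Euc d)}
    (hchart : ∀ u : M, u ∉ nonregular M d → chart u ∈ 𝒜 ∧ u ∈ (chart u).source)
    {A X : Set (Euc m)} (hXA : X ⊆ A) {a : ℝ} (hX : HasCON X a)
    {c : M → Euc m → Euc j}
    (hc : ContinuousOn (fun p : M × Euc m => c p.1 p.2) (Set.univ ×ˢ A))
    (hc1 : ∀ u ∉ degenerate d A X c, ∀ x ∈ A, C1At d c u x)
    (hτ : tau A X c chart < ⊤)
    (hdisj : ∀ x ∈ X, admissible c x ∩ degenerate d A X c = ∅)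
    {x₁ x₂ : Euc m} (hx₁ : x₁ ∈ X) (hx₂ : x₂ ∈ X) {u : M} (hu : u ∈ admissible c x₁) :
    Metric.infEDist u (admissible c x₂) ≤
      ENNReal.ofReal a * tau A X c chart * lipAtlas 𝒜 * edist x₁ x₂ := by
  have : CompactSpace M := isCompact_iff_compactSpace.1 hM
  rcases eq_or_ne x₁ x₂ with rfl | hne
  · simp [Metric.infEDist_zero_of_mem hu]
  obtain ⟨w₁, w₂, γ, hγ, hγX, rfl, rfl, hlen⟩ := hX.exists_arc x₁ hx₁ x₂ hx₂ hne
  have hLip := (lipAtlas_lt_top h𝒜).ne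
  set L : ℝ≥0 := (lipAtlas 𝒜).toNNReal
  have hL : (L : ℝ≥0∞) = lipAtlas 𝒜 := ENNReal.coe_toNNReal hLip
  -- The lift needs a constant strictly above the derivative norm, so the estimate is first proved
  -- for each `k > τ`.
  have key : ∀ k : ℝ≥0, tau A X c chart < k → Metric.infEDist u (admissible c (γ w₂)) ≤
      k * (lipAtlas 𝒜 * (ENNReal.ofReal a * edist (γ w₁) (γ w₂))) := by
    intro k hk
    have hw₁ : w₁ ∈ Icc w₁ w₂ := left_mem_Icc.2 hγ.lt.le
    have hint : ∀ s ∈ Icc w₁ w₂, ∀ t ∈ Icc w₁ w₂,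
        IntervalIntegrable (fun t => ‖derivWithin γ (Icc w₁ w₂) t‖) volume s t :=
      fun s hs t ht => (hγ.intervalIntegrable_derivWithin hs ht).norm
    have hstep : ∀ t ∈ Ico w₁ w₂, ∀ v ∈ admissible c (γ t), ∀ᶠ t' in 𝓝[>] t,
        ∃ v' ∈ admissible c (γ t'), dist v v' ≤
          (L * k * ∫ r in w₁..t', ‖derivWithin γ (Icc w₁ w₂) r‖) -
            L * k * ∫ r in w₁..t, ‖derivWithin γ (Icc w₁ w₂) r‖ := by
      intro t ht v hv
      have htI : t ∈ Icc w₁ w₂ := Ico_subset_Icc_self ht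
      have hvD : v ∉ degenerate d A X c := fun h =>
        (hdisj _ (hγX t htI)).subset ⟨hv, h⟩
      have hvr : v ∉ nonregular M d := fun h => hvD (Or.inl (Or.inl h))
      obtain ⟨hψ𝒜, hψs⟩ := hchart v hvr
      have hψ := h𝒜reg v hvr _ hψ𝒜 hψs
      obtain ⟨π, hπ⟩ := exists_isInvertible_of_notMem_degenerate hψ hvD (hγX t htI) hv
      have hnorm : ‖(controlJacobian (chart v) c v (γ t) π).inverse ∘L fderiv ℝ (c v) (γ t)‖ₑ
          ≤ tau A X c chart :=
        le_iSup₂_of_le (γ t) (hγX t htI) (le_iSup₂_of_le v ⟨hv, hvD⟩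
          (le_iSup₂_of_le (f := fun π _ => _) π hπ le_rfl))
      have hlift := eventually_exists_lift hψ (hc1 v hvD _ (hXA (hγX t htI))) hπ
        (hnorm.trans_lt hk)
      have hγt : Tendsto γ (𝓝[>] t) (𝓝 (γ t)) :=
        (hγ.continuousOn t htI).mono_of_mem_nhdsWithin (Icc_mem_nhdsGT_of_mem ht)
      filter_upwards [hγt.eventually hlift, Ioc_mem_nhdsGT ht.2] with t' ⟨v', hcv, hd⟩ ht'
      refine ⟨v', admissible_of_eq hcv hv, ?_⟩
      have ht'I : t' ∈ Icc w₁ w₂ := ⟨ht.1.trans ht'.1.le, ht'.2⟩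
      have h1 : lipConst (param (chart v)) (chart v).target ≤ L := by
        rw [hL]
        exact le_iSup₂_of_le (f := fun ψ _ => lipConst (param ψ) ψ.target) _ hψ𝒜 le_rfl
      have h2 : edist v v' ≤ L * (k * edist (γ t) (γ t')) := hd.trans (by gcongr)
      have h3 : dist v v' ≤ L * (k * dist (γ t) (γ t')) := by
        rw [edist_nndist, edist_nndist] at h2
        exact_mod_cast h2
      -- The chord `dist (γ t) (γ t')` is replaced by the arc length in between, which is additive
      -- as the induction requires.
      rw [← mul_sub, intervalIntegral.integral_interval_sub_left (hint _ hw₁ _ ht'I)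
        (hint _ hw₁ _ htI), mul_assoc]
      refine h3.trans ?_
      gcongr
      rw [dist_comm, dist_eq_norm]
      exact hγ.norm_sub_le htI ht'I ht'.1.le
    obtain ⟨u', hu', hd⟩ := exists_mem_dist_le_of_local (U := fun t => admissible c (γ t))
      (s := fun t => L * k * ∫ r in w₁..t, ‖derivWithin γ (Icc w₁ w₂) r‖) hγ.lt.le
      (continuousOn_const.mul (intervalIntegral.continuousOn_primitive_interval'
        (hint w₁ hw₁ w₂ (right_mem_Icc.2 hγ.lt.le)) left_mem_uIcc |>.mono (by
          rw [uIcc_of_le hγ.lt.le])))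
      (isClosed_setOf_mem_admissible hc isClosed_Icc hγ.continuousOn fun t ht => hXA (hγX t ht))
      hstep hu
    refine (Metric.infEDist_le_edist_of_mem hu').trans ?_
    rw [edist_dist, edist_dist, ← hL, ← ENNReal.ofReal_coe_nnreal, ← ENNReal.ofReal_coe_nnreal,
      ← ENNReal.ofReal_mul hX.pos.le, ← ENNReal.ofReal_mul L.coe_nonneg,
      ← ENNReal.ofReal_mul k.coe_nonneg]
    refine ENNReal.ofReal_le_ofReal (hd.trans ?_)
    rw [intervalIntegral.integral_same, mul_zero, sub_zero, mul_comm (L : ℝ), mul_assoc]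
    have : ∫ r in w₁..w₂, ‖derivWithin γ (Icc w₁ w₂) r‖ ≤ a * dist (γ w₁) (γ w₂) := hlen
    gcongr
  have hC : lipAtlas 𝒜 * (ENNReal.ofReal a * edist (γ w₁) (γ w₂)) ≠ ⊤ :=
    ENNReal.mul_ne_top hLip (ENNReal.mul_ne_top ENNReal.ofReal_ne_top (edist_ne_top _ _))
  -- Let `k` decrease to `τ`; since `τ < ⊤`, there are values above it, and the other factor is
  -- finite, so the product converges.
  have : (𝓝[>] tau A X c chart).NeBot := nhdsGT_neBot_of_exists_gt ⟨⊤, hτ⟩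
  have hlim := ENNReal.Tendsto.mul_const (b := lipAtlas 𝒜 * (ENNReal.ofReal a *
    edist (γ w₁) (γ w₂))) (tendsto_id.mono_left (nhdsWithin_le_nhds (a := tau A X c chart)
    (s := Ioi (tau A X c chart)))) (Or.inr hC)
  refine (ge_of_tendsto hlim ?_).trans_eq (by ring)
  filter_upwards [Ioo_mem_nhdsGT hτ] with k hk
  have := key k.toNNReal (by rw [ENNReal.coe_toNNReal hk.2.ne]; exact hk.1)
  rwa [ENNReal.coe_toNNReal hk.2.ne] at this

end LipControl

theorem mainTheorem1 {n m d j : ℕ} (hjd : j ≤ d)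
    (M : Set (LipControl.Euc n)) (hM : IsCompact M) (hMd : LipControl.IsLipManifold M d)
    -- the atlas, all of whose charts are regular at the regular points of `M`
    (𝒜 : Set (OpenPartialHomeomorph M (LipControl.Euc d))) (h𝒜 : LipControl.IsAtlas 𝒜)
    (h𝒜reg : ∀ u : M, u ∉ LipControl.nonregular M d → ∀ ψ ∈ 𝒜, u ∈ ψ.source →
      LipControl.IsRegularChart ψ u)
    -- the regular chart chosen for each regular point
    (chart : M → OpenPartialHomeomorph M (LipControl.Euc d))
    (hchart : ∀ u : M, u ∉ LipControl.nonregular M d → chart u ∈ 𝒜 ∧ u ∈ (chart u).source)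
    (A : Set (LipControl.Euc m)) (hA : IsOpen A)
    (X : Set (LipControl.Euc m)) (hXA : X ⊆ A) (a : ℝ) (hX : LipControl.HasCON X a)
    (c : M → LipControl.Euc m → LipControl.Euc j)
    (hU : ∀ x ∈ X, (LipControl.admissible c x).Nonempty)
    (hD : IsClosed (LipControl.degenerate d A X c))
    (hc : ContinuousOn (fun p : M × LipControl.Euc m => c p.1 p.2) (Set.univ ×ˢ A))
    (hc1 : ∀ u ∉ LipControl.degenerate d A X c, ∀ x ∈ A, LipControl.C1At d c u x)
    (hτ : LipControl.tau A X c chart < ⊤) :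
    (∀ x ∈ X, IsCompact (LipControl.admissible c x)) ∧
    -- case (A)
    ((∀ x ∈ X, LipControl.admissible c x ∩ LipControl.degenerate d A X c = ∅) →
      ∀ x₁ ∈ X, ∀ x₂ ∈ X,
        Metric.hausdorffEDist (LipControl.admissible c x₁) (LipControl.admissible c x₂) ≤
          ENNReal.ofReal a * LipControl.tau A X c chart * LipControl.lipAtlas 𝒜 * edist x₁ x₂) ∧
    -- case (B)
    (((LipControl.degenerate d A X c).Nonempty ∧
        ∀ x ∈ X, ∀ u ∈ LipControl.admissible c x ∩ LipControl.degenerate d A X c,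
          u ∈ closure (LipControl.admissible c x \ LipControl.degenerate d A X c)) →
      ∀ K ⊆ X, IsCompact K → (∃ b : ℝ, LipControl.HasCON K b) →
        ∀ ε > 0, ∃ δ > 0, ∀ x ∈ K, ∀ y ∈ K, dist x y < δ →
          Metric.hausdorffDist (LipControl.admissible c x) (LipControl.admissible c y) < ε) := by
  have hMc : CompactSpace M := isCompact_iff_compactSpace.1 hM
  refine ⟨fun x hx => ?_, fun hdisj x₁ hx₁ x₂ hx₂ => ?_, fun hB K hKX hK _ => ?_⟩
  -- Over a one-point parameter space the graph is a copy of `U(x)`.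
  · have h := LipControl.isClosed_setOf_mem_admissible hc (isClosed_univ (X := Unit))
      (γ := fun _ => x) continuousOn_const fun _ _ => hXA hx
    have h' := h.preimage (Continuous.prodMk_right ())
    exact IsClosed.isCompact (by simpa using h')
  · refine Metric.hausdorffEDist_le_of_infEDist (fun u hu => ?_) fun u hu => ?_
    · exact LipControl.infEDist_admissible_le hM h𝒜 h𝒜reg hchart hXA hX hc hc1 hτ hdisj hx₁ hx₂ hu
    · rw [edist_comm]
      exact LipControl.infEDist_admissible_le hM h𝒜 h𝒜reg hchart hXA hX hc hc1 hτ hdisj hx₂ hx₁ hu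
  · exact LipControl.hausdorffDist_admissible_uniform hM hXA hU hc hc1 hB.2 hKX hK
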